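/- Theorem (Anisotropic Norm Bounded Real Lemma). Let $F$ be a linear discrete time varying system $x_{k+1}=A_kx_k+B_kw_k$, $z_k=C_kx_k+D_kw_k$, $x_0=0$, on a time interval $[0,N]$, with real matrices $A_k\in\mathbb R^{n\times n}$, $B_k\in\mathbb R^{n\times m}$, $C_k\in\mathbb R^{r\times n}$, $D_k\in\mathbb R^{r\times m}$, and let $F_{0:N}$ be the block lower triangular matrix that maps the input $W=(w_0,\ldots,w_N)\in\mathbb R^{\ell}$, $\ell:=m(N+1)$, to the output $(z_0,\ldots,z_N)$: its $(j,k)$ block, $0\le j,k\le N$, is $C_jA_{j-1}\cdots A_{k+1}B_k$ for $j>k$, $D_k$ for $j=k$ and $0$ for $j<k$. The anisotropy of a square integrable absolutely continuous random vector $W$ in $\mathbb R^{\ell}$ is $\mathbf A(W):=\inf_{\lambda>0}\mathbf D(W\,\|\,\mathcal N(0,\lambda I_\ell))$, where $\mathbf D$ is the relative entropy, and for $a\ge 0$ the $a$-anisotropic norm of $F$ is $$|||F|||_a:=\sup\Big\{\sqrt{\mathbf E|F_{0:N}W|^2/\mathbf E|W|^2}\;:\;W\text{ square integrable and absolutely continuous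 in }\mathbb R^\ell,\ \mathbf A(W)\le a\Big\}.$$ Let $a>0$ and $\gamma\ge 0$, and suppose that $F_{0:N}^{\mathrm T}F_{0:N}\ne\gamma^2I_{\ell}$ (in particular, $m\ge 1$). Then $|||F|||_a\le\gamma$ if and only if there exists $q\ge 0$ with $q\gamma^2<1$ such that, for the matrices given by $$R_{k+1}=A_kR_kA_k^{\mathrm T}+qB_kB_k^{\mathrm T}+M_kS_kM_k^{\mathrm T},\qquad R_0=0,$$ $$M_k=-(A_kR_kC_k^{\mathrm T}+qB_kD_k^{\mathrm T})S_k^{-1},\qquad S_k=I_r-C_kR_kC_k^{\mathrm T}-qD_kD_k^{\mathrm T},$$ the matrices $S_0,\ldots,S_N$ are all positive definite and satisfy $$\sum_{k=0}^{N}\ln\det S_k\ \ge\ m(N+1)\ln(1-q\gamma^2)+2a.$$ -/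

import Mathlib

open Matrix MeasureTheory
open scoped ENNReal

noncomputable section

/-- The zero-mean Gaussian density `p_{ℓ,v}` on `ℝ^ι` (with `ℓ` the number of coordinates) with
scalar covariance matrix `v • I`. -/
def scalarGaussianPDF (ι : Type) [Fintype ι] (v : ℝ) (w : EuclideanSpace ℝ ι) : ℝ :=
  (2 * Real.pi * v) ^ (-(Fintype.card ι : ℝ) / 2) * Real.exp (-‖w‖ ^ 2 / (2 * v))

/-- The Gaussian law on `ℝ^ι` with zero mean and covariance matrix `v • I`. -/
def scalarGaussian (ι : Type) [Fintype ι] (v : ℝ) : Measure (EuclideanSpace ℝ ι) :=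
  volume.withDensity fun w => ENNReal.ofReal (scalarGaussianPDF ι v w)

/-- `μ` is the law of a square integrable absolutely continuous random vector in `ℝ^ι`. -/
structure IsL2ACLaw {ι : Type} [Fintype ι] (μ : Measure (EuclideanSpace ℝ ι)) : Prop where
  isProbabilityMeasure : IsProbabilityMeasure μ
  absolutelyContinuous : μ ≪ volume
  squareIntegrable : MemLp (fun w : EuclideanSpace ℝ ι => w) 2 μ

/-- The anisotropy of a random vector with law `μ`: the minimal relative entropy
(Kullback-Leibler divergence, possibly `∞`) of `μ` with respect to the zero-mean Gaussian laws
with scalar covariance matrices. -/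
def anisotropy {ι : Type} [Fintype ι] (μ : Measure (EuclideanSpace ℝ ι)) : ℝ≥0∞ :=
  ⨅ (v : ℝ) (_ : 0 < v), InformationTheory.klDiv μ (scalarGaussian ι v)

/-- The root-mean-square gain `√(E|F W|² / E|W|²)` of a matrix `F` with respect to a random
vector `W` with law `μ`. -/
def rmsGain {σ ι : Type} [Fintype σ] [Fintype ι] [DecidableEq ι] (F : Matrix σ ι ℝ)
    (μ : Measure (EuclideanSpace ℝ ι)) : ℝ :=
  Real.sqrt ((∫ w, ‖Matrix.toEuclideanLin F w‖ ^ 2 ∂μ) / ∫ w, ‖w‖ ^ 2 ∂μ)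

/-- The `a`-anisotropic norm of a matrix `F`: the supremum of the root-mean-square gains of `F`
over all square integrable absolutely continuous random vectors `W` with anisotropy at most `a`.
The supremum is taken in `[0, ∞]`. -/
def anisotropicNorm {σ ι : Type} [Fintype σ] [Fintype ι] [DecidableEq ι] (F : Matrix σ ι ℝ)
    (a : ℝ) : ℝ≥0∞ :=
  ⨆ (μ : Measure (EuclideanSpace ℝ ι)) (_ : IsL2ACLaw μ)
    (_ : anisotropy μ ≤ ENNReal.ofReal a), ENNReal.ofReal (rmsGain F μ)

/-- A linear discrete time varying system with `n`-dimensional state, `m`-dimensional input and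
`r`-dimensional output, `x (k+1) = A k x k + B k w k`, `z k = C k x k + D k w k`, `x 0 = 0`.
On the time interval `[0, N]` only the matrices with index `k ≤ N` matter. -/
structure LDTVSystem (n m r : ℕ) where
  A : ℕ → Matrix (Fin n) (Fin n) ℝ
  B : ℕ → Matrix (Fin n) (Fin m) ℝ
  C : ℕ → Matrix (Fin r) (Fin n) ℝ
  D : ℕ → Matrix (Fin r) (Fin m) ℝ

namespace LDTVSystem

variable {n m r : ℕ} (F : LDTVSystem n m r)

/-- The state transition matrix `Φ j k = A (j-1) * ⋯ * A k` from time `k` to time `j ≥ k`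
(the identity matrix for `j = k`; its value for `j < k` is never used). -/
def transition : ℕ → ℕ → Matrix (Fin n) (Fin n) ℝ
  | 0, _ => 1
  | j + 1, k => if k ≤ j then F.A j * transition j k else 1

/-- The `(j, k)` block of the input-output matrix. -/
def block (j k : ℕ) : Matrix (Fin r) (Fin m) ℝ :=
  if k < j then F.C j * F.transition j (k + 1) * F.B k
  else if j = k then F.D k
  else 0

/-- The block lower triangular matrix `F_{0:N}` which maps the input `(w 0, …, w N)` to the
output `(z 0, …, z N)`. -/
def ioMatrix (N : ℕ) : Matrix (Fin (N + 1) × Fin r) (Fin (N + 1) × Fin m) ℝ :=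
  Matrix.of fun j k => F.block j.1 k.1 j.2 k.2

/-- The matrix `S k` as a function of `R = R k`. -/
def riccatiStepS (q : ℝ) (k : ℕ) (R : Matrix (Fin n) (Fin n) ℝ) : Matrix (Fin r) (Fin r) ℝ :=
  1 - F.C k * R * (F.C k)ᵀ - q • (F.D k * (F.D k)ᵀ)

/-- The matrix `M k` as a function of `R = R k`. -/
def riccatiStepM (q : ℝ) (k : ℕ) (R : Matrix (Fin n) (Fin n) ℝ) : Matrix (Fin n) (Fin r) ℝ :=
  -(F.A k * R * (F.C k)ᵀ + q • (F.B k * (F.D k)ᵀ)) * (F.riccatiStepS q k R)⁻¹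

/-- The solution `R k` of the forward difference Riccati equation with `R 0 = 0`. -/
def riccatiR (q : ℝ) : ℕ → Matrix (Fin n) (Fin n) ℝ
  | 0 => 0
  | k + 1 =>
    F.A k * riccatiR q k * (F.A k)ᵀ + q • (F.B k * (F.B k)ᵀ)
      + F.riccatiStepM q k (riccatiR q k) * F.riccatiStepS q k (riccatiR q k)
        * (F.riccatiStepM q k (riccatiR q k))ᵀ

/-- The matrix `S k` associated with the Riccati equation. -/
def riccatiS (q : ℝ) (k : ℕ) : Matrix (Fin r) (Fin r) ℝ :=
  F.riccatiStepS q k (F.riccatiR q k)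

end LDTVSystem

end

/-!
Write `G = FᵀF` for the input-output matrix `F = F_{0:N}`, let `g i` be the eigenvalues of `G` and
`ℓ = m (N + 1)`. The theorem combines two facts.

*The Riccati equation factorizes `1 - q F Fᵀ`.* If `L` is the input-output matrix of the system with
matrices `A k`, `M k`, `C k`, `1`, then `1 - q F Fᵀ = L diag(S 0, …, S N) Lᵀ`
(`LDTVSystem.one_sub_smul_ioMatrix_mul_transpose`): both sides are state-space expressions for
covariances, with the solutions of Lyapunov equations as state covariances. As `L` is block unit
lower triangular, positivity of all `S k` is positivity of `1 - q F Fᵀ`, equivalently of `1 - q G`,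
and `∏ det (S k) = det (1 - q G)`. What remains is a statement on the single matrix `F`
(`anisotropicNorm_le_iff`): the norm is at most `γ` if and only if `ln det (1 - q G) ≥
ℓ ln (1 - q γ²) + 2 a` for some `q ≥ 0` with `q γ² < 1` and `1 - q G` positive definite.

*Gaussian laws with precision matrix `1 - q G` are extremal.* The Donsker–Varadhan inequality, with
a Gaussian law of precision matrix proportional to `1 - q G` as the competitor, bounds the
anisotropy of any input below in terms of its gain (`IsL2ACLaw.le_anisotropy`), and this gives
sufficiency (`anisotropicNorm_le_of_log_le`). For necessity, if `G` is not scalar and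
`γ² ≤ max g`, the intermediate value theorem yields a `q < 1 / max g` for which the Gaussian
input with precision matrix `1 - q G` has anisotropy exactly `a`
(`exists_gaussian_anisotropy_eq`); that its gain is at most `γ` gives the required
inequality. If `γ² > max g`, every `q < 1 / γ²` close enough to `1 / γ²` works, and a scalar
`G = c` with `c > γ²` is excluded by the standard Gaussian input. The hypothesis `G ≠ γ²` removes the one remaining case.
-/

/-! ### Block diagonal matrices and Schur complements -/

/-- The block diagonal matrix with blocks `V 0, …, V N`, indexed like `LDTVSystem.ioMatrix`. -/
def timeBlockDiagonal {p : ℕ} (N : ℕ) (V : ℕ → Matrix (Fin p) (Fin p) ℝ) :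
    Matrix (Fin (N + 1) × Fin p) (Fin (N + 1) × Fin p) ℝ :=
  (blockDiagonal fun k : Fin (N + 1) => V k).submatrix Prod.swap Prod.swap

theorem timeBlockDiagonal_apply {p : ℕ} (N : ℕ) (V : ℕ → Matrix (Fin p) (Fin p) ℝ)
    (x y : Fin (N + 1) × Fin p) :
    timeBlockDiagonal N V x y = if x.1 = y.1 then V x.1 x.2 y.2 else 0 := by
  simp [timeBlockDiagonal, blockDiagonal_apply]

theorem det_timeBlockDiagonal {p : ℕ} (N : ℕ) (V : ℕ → Matrix (Fin p) (Fin p) ℝ) :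
    (timeBlockDiagonal N V).det = ∏ k ∈ Finset.range (N + 1), (V k).det := by
  rw [Finset.prod_range, ← det_blockDiagonal]
  exact det_submatrix_equiv_self (Equiv.prodComm _ _) _

theorem timeBlockDiagonal_smul_one {p : ℕ} (N : ℕ) (c : ℝ) :
    timeBlockDiagonal N (fun _ => c • (1 : Matrix (Fin p) (Fin p) ℝ)) = c • 1 := by
  ext x y
  rcases eq_or_ne x.1 y.1 with h | h <;>
    simp [timeBlockDiagonal_apply, Matrix.one_apply, Prod.ext_iff, h]

theorem timeBlockDiagonal_posDef_iff {p : ℕ} (N : ℕ) (V : ℕ → Matrix (Fin p) (Fin p) ℝ) :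
    (timeBlockDiagonal N V).PosDef ↔ ∀ k ≤ N, (V k).PosDef := by
  constructor
  · intro h k hk
    have h1 := h.submatrix (e := fun a : Fin p => ((⟨k, by omega⟩ : Fin (N + 1)), a))
      (fun a b hab => by simpa using hab)
    convert! h1 using 1
    ext a b
    simp [timeBlockDiagonal_apply]
  · intro h
    have hsymm : ∀ k ≤ N, ∀ a b, V k b a = V k a b := fun k hk a b => by
      simpa using (h k hk).1.apply a b
    refine PosDef.of_dotProduct_mulVec_pos ?_ fun x hx => ?_
    · ext x y
      simp only [conjTranspose_apply, timeBlockDiagonal_apply, star_trivial]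
      rcases eq_or_ne x.1 y.1 with hxy | hxy
      · rw [if_pos hxy, if_pos hxy.symm, ← hxy, hsymm _ (by omega)]
      · rw [if_neg hxy, if_neg hxy.symm]
    · have hsum : star x ⬝ᵥ (timeBlockDiagonal N V *ᵥ x)
          = ∑ k : Fin (N + 1), star (fun a => x (k, a)) ⬝ᵥ (V k *ᵥ fun a => x (k, a)) := by
        simp only [dotProduct, mulVec, Fintype.sum_prod_type, timeBlockDiagonal_apply,
          star_trivial, Pi.star_apply, ite_mul, zero_mul]
        refine Finset.sum_congr rfl fun k _ => Finset.sum_congr rfl fun a _ => ?_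
        rw [Finset.sum_comm]
        simp
      rw [hsum]
      obtain ⟨⟨k, a⟩, hka⟩ := Function.ne_iff.1 hx
      refine Finset.sum_pos' (fun i _ => ?_) ⟨k, Finset.mem_univ _, ?_⟩
      · exact (posSemidef_iff_dotProduct_mulVec.1 (h i (by omega)).posSemidef).2 _
      · exact (h k (by omega)).dotProduct_mulVec_pos fun h0 => hka (congrFun h0 a)

/-- Both conditions are that the block matrix with diagonal blocks `1` and off-diagonal blocks
`√q F`, `√q Fᵀ` is positive definite. -/
theorem posDef_one_sub_smul_mul_transpose_iff {σ ι : Type*} [Fintype σ] [Fintype ι]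
    [DecidableEq σ] [DecidableEq ι] (F : Matrix σ ι ℝ) {q : ℝ} (hq : 0 ≤ q) :
    (1 - q • (F * Fᵀ)).PosDef ↔ (1 - q • (Fᵀ * F)).PosDef := by
  have hs : √q * √q = q := Real.mul_self_sqrt hq
  have h1 : (fromBlocks 1 (√q • F) (√q • F)ᴴ 1).PosSemidef ↔ (1 - q • (Fᵀ * F)).PosSemidef := by
    let _ : Invertible (1 : Matrix σ σ ℝ) := invertibleOne
    rw [PosDef.fromBlocks₁₁ _ _ PosDef.one]
    simp [smul_smul, hs, conjTranspose_eq_transpose_of_trivial]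
  have h2 : (fromBlocks 1 (√q • F) (√q • F)ᴴ 1).PosSemidef ↔ (1 - q • (F * Fᵀ)).PosSemidef := by
    let _ : Invertible (1 : Matrix ι ι ℝ) := invertibleOne
    rw [PosDef.fromBlocks₂₂ _ _ PosDef.one]
    simp [smul_smul, hs, conjTranspose_eq_transpose_of_trivial]
  have hdet : (1 - q • (F * Fᵀ)).det = (1 - q • (Fᵀ * F)).det := by
    rw [← Matrix.smul_mul, det_one_sub_mul_comm, Matrix.mul_smul]
  constructor
  · intro h
    rw [(h1.1 (h2.2 h.posSemidef)).posDef_iff_det_ne_zero, ← hdet]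
    exact h.det_pos.ne'
  · intro h
    rw [(h2.1 (h1.2 h.posSemidef)).posDef_iff_det_ne_zero, hdet]
    exact h.det_pos.ne'

/-! ### Factorization along the Riccati equation -/

namespace LDTVSystem

variable {n m r : ℕ}

theorem transition_self (F : LDTVSystem n m r) (k : ℕ) : F.transition k k = 1 := by
  cases k <;> simp [transition]

theorem transition_succ (F : LDTVSystem n m r) {j k : ℕ} (h : k ≤ j) :
    F.transition (j + 1) k = F.A j * F.transition j k := by
  simp [transition, h]

theorem transition_mul_transition (F : LDTVSystem n m r) {j l k : ℕ} (hlj : l ≤ j) (hkl : k ≤ l) :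
    F.transition j l * F.transition l k = F.transition j k := by
  induction j, hlj using Nat.le_induction with
  | base => simp [transition_self]
  | succ j hlj ih =>
    rw [F.transition_succ hlj, F.transition_succ (hkl.trans hlj), Matrix.mul_assoc, ih]

theorem block_of_lt (F : LDTVSystem n m r) {j k : ℕ} (h : k < j) :
    F.block j k = F.C j * F.transition j (k + 1) * F.B k := if_pos h

theorem block_self (F : LDTVSystem n m r) (j : ℕ) : F.block j j = F.D j := by simp [block]

theorem block_of_gt (F : LDTVSystem n m r) {j k : ℕ} (h : j < k) : F.block j k = 0 := by
  simp [block, h.not_gt, h.ne]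

/-- The solution of a Lyapunov equation is the state covariance at time `k` for uncorrelated inputs
with covariances `V i`. -/
theorem sum_transition_eq (F : LDTVSystem n m r) (V : ℕ → Matrix (Fin m) (Fin m) ℝ)
    {P : ℕ → Matrix (Fin n) (Fin n) ℝ} (hP0 : P 0 = 0)
    (hP : ∀ k, P (k + 1) = F.A k * P k * (F.A k)ᵀ + F.B k * V k * (F.B k)ᵀ) (k : ℕ) :
    ∑ i ∈ Finset.range k, F.transition k (i + 1) * F.B i * V i
      * (F.transition k (i + 1) * F.B i)ᵀ = P k := by
  induction k with
  | zero => simp [hP0]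
  | succ k ih =>
    rw [Finset.sum_range_succ, transition_self, hP, ← ih, Matrix.mul_sum, Matrix.sum_mul]
    congr 1
    · refine Finset.sum_congr rfl fun i hi => ?_
      rw [F.transition_succ (by have := Finset.mem_range.1 hi; omega)]
      simp only [transpose_mul, Matrix.mul_assoc]
    · simp

theorem sum_block_eq_self (F : LDTVSystem n m r) (V : ℕ → Matrix (Fin m) (Fin m) ℝ)
    {P : ℕ → Matrix (Fin n) (Fin n) ℝ} (hP0 : P 0 = 0)
    (hP : ∀ k, P (k + 1) = F.A k * P k * (F.A k)ᵀ + F.B k * V k * (F.B k)ᵀ)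
    {N k : ℕ} (hk : k ≤ N) :
    ∑ i ∈ Finset.range (N + 1), F.block k i * V i * (F.block k i)ᵀ
      = F.C k * P k * (F.C k)ᵀ + F.D k * V k * (F.D k)ᵀ := by
  rw [← Finset.sum_subset (s₁ := Finset.range (k + 1))
    (Finset.range_mono (by omega)) fun i _ hi => by
      rw [F.block_of_gt (by simpa using hi)]; simp, Finset.sum_range_succ, block_self,
    ← F.sum_transition_eq V hP0 hP k, Matrix.mul_sum, Matrix.sum_mul]
  congr 1
  refine Finset.sum_congr rfl fun i hi => ?_
  rw [F.block_of_lt (Finset.mem_range.1 hi)]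
  simp only [transpose_mul, Matrix.mul_assoc]

theorem sum_block_eq_of_lt (F : LDTVSystem n m r) (V : ℕ → Matrix (Fin m) (Fin m) ℝ)
    {P : ℕ → Matrix (Fin n) (Fin n) ℝ} (hP0 : P 0 = 0)
    (hP : ∀ k, P (k + 1) = F.A k * P k * (F.A k)ᵀ + F.B k * V k * (F.B k)ᵀ)
    {N j k : ℕ} (hk : k ≤ N) (hkj : k < j) :
    ∑ i ∈ Finset.range (N + 1), F.block j i * V i * (F.block k i)ᵀ
      = F.C j * F.transition j (k + 1)
        * (F.A k * P k * (F.C k)ᵀ + F.B k * V k * (F.D k)ᵀ) := by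
  rw [← Finset.sum_subset (s₁ := Finset.range (k + 1))
    (Finset.range_mono (by omega)) fun i _ hi => by
      rw [F.block_of_gt (j := k) (by simpa using hi)]; simp, Finset.sum_range_succ, block_self,
    ← F.sum_transition_eq V hP0 hP k, Matrix.mul_add, Matrix.mul_sum, Matrix.sum_mul,
    Matrix.mul_sum, F.block_of_lt hkj]
  congr 1
  · refine Finset.sum_congr rfl fun i hi => ?_
    have hi' := Finset.mem_range.1 hi
    rw [F.block_of_lt hi', F.block_of_lt (hi'.trans hkj),
      ← F.transition_mul_transition (l := k + 1) (by omega) (by omega),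
      F.transition_succ (by omega)]
    simp only [transpose_mul, Matrix.mul_assoc]
  · simp only [Matrix.mul_assoc]

theorem ioMatrix_mul_timeBlockDiagonal_mul_transpose_apply (F : LDTVSystem n m r) (N : ℕ)
    (V : ℕ → Matrix (Fin m) (Fin m) ℝ) (x y : Fin (N + 1) × Fin r) :
    (F.ioMatrix N * timeBlockDiagonal N V * (F.ioMatrix N)ᵀ) x y
      = (∑ i ∈ Finset.range (N + 1), F.block x.1 i * V i * (F.block y.1 i)ᵀ) x.2 y.2 := by
  rw [Finset.sum_range, Matrix.sum_apply]
  simp only [Matrix.mul_apply, ioMatrix, timeBlockDiagonal_apply, Fintype.sum_prod_type, of_apply,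
    transpose_apply, mul_ite, mul_zero]
  refine Finset.sum_congr rfl fun i _ => Finset.sum_congr rfl fun c _ => ?_
  congr 1
  rw [Finset.sum_comm]
  simp

/-- If the blocks of the feedthrough are identities, the input-output matrix is block unit lower
triangular. -/
theorem det_ioMatrix_of_D_eq_one (L : LDTVSystem n r r) (hD : ∀ k, L.D k = 1) (N : ℕ) :
    (L.ioMatrix N).det = 1 := by
  have hT : (L.ioMatrix N)ᵀ.BlockTriangular Prod.fst := by
    intro x y hxy
    simp [ioMatrix, L.block_of_gt (j := y.1) (k := x.1) hxy]
  rw [← det_transpose, hT.det_fintype]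
  refine Finset.prod_eq_one fun k _ => ?_
  rw [← det_one (R := ℝ) (n := {x : Fin (N + 1) × Fin r // x.1 = k})]
  congr 1
  ext ⟨x, hx⟩ ⟨y, hy⟩
  have hxy : x.1 = y.1 := hx.trans hy.symm
  simp only [toSquareBlock_def, of_apply, transpose_apply, ioMatrix, hxy, block_self, hD]
  simp only [Matrix.one_apply, Subtype.mk.injEq, Prod.ext_iff, hxy, true_and, eq_comm]

variable (F : LDTVSystem n m r)

/-- The system `x̂ (k+1) = A k x̂ k + M k s k`, `y k = C k x̂ k + s k` built from the Riccati
equation. Its input-output matrix is the block unit triangular factor of `1 - q F Fᵀ`. -/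
noncomputable def riccatiFactor (q : ℝ) : LDTVSystem n r r where
  A := F.A
  B k := F.riccatiStepM q k (F.riccatiR q k)
  C := F.C
  D _ := 1

theorem riccatiFactor_transition (q : ℝ) (j k : ℕ) :
    (F.riccatiFactor q).transition j k = F.transition j k := by
  induction j with
  | zero => rfl
  | succ j ih => simp only [transition, ih]; rfl

theorem riccatiStepS_transpose (q : ℝ) (k : ℕ) {R : Matrix (Fin n) (Fin n) ℝ} (hR : Rᵀ = R) :
    (F.riccatiStepS q k R)ᵀ = F.riccatiStepS q k R := by
  simp [riccatiStepS, transpose_mul, hR, Matrix.mul_assoc]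

theorem riccatiR_transpose (q : ℝ) (k : ℕ) : (F.riccatiR q k)ᵀ = F.riccatiR q k := by
  induction k with
  | zero => simp [riccatiR]
  | succ k ih =>
    simp [riccatiR, transpose_mul, ih, F.riccatiStepS_transpose q k ih, Matrix.mul_assoc]

theorem riccatiS_transpose (q : ℝ) (k : ℕ) : (F.riccatiS q k)ᵀ = F.riccatiS q k :=
  F.riccatiStepS_transpose q k (F.riccatiR_transpose q k)

/-- The state covariance `P` of the given system for white inputs with covariance `q`. -/
noncomputable def controllabilityGramian (q : ℝ) : ℕ → Matrix (Fin n) (Fin n) ℝ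
  | 0 => 0
  | k + 1 => F.A k * controllabilityGramian q k * (F.A k)ᵀ
      + F.B k * (q • (1 : Matrix (Fin m) (Fin m) ℝ)) * (F.B k)ᵀ

/-- The factorization `1 - q F Fᵀ = L diag(S 0, …, S N) Lᵀ`. With `P` the controllability
Gramian, `R - P` is the state covariance of `riccatiFactor` for inputs with covariances `S k`. -/
theorem one_sub_smul_ioMatrix_mul_transpose (q : ℝ) (N : ℕ)
    (hS : ∀ k < N, IsUnit (F.riccatiS q k)) :
    1 - q • (F.ioMatrix N * (F.ioMatrix N)ᵀ)
      = (F.riccatiFactor q).ioMatrix N * timeBlockDiagonal N (F.riccatiS q)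
        * ((F.riccatiFactor q).ioMatrix N)ᵀ := by
  set L := F.riccatiFactor q
  set P := F.controllabilityGramian q
  have hP : ∀ k, P (k + 1) = F.A k * P k * (F.A k)ᵀ
      + F.B k * (q • (1 : Matrix (Fin m) (Fin m) ℝ)) * (F.B k)ᵀ := fun k => rfl
  have hΔ : ∀ k, F.riccatiR q (k + 1) - P (k + 1)
      = L.A k * (F.riccatiR q k - P k) * (L.A k)ᵀ + L.B k * F.riccatiS q k * (L.B k)ᵀ := by
    intro k
    rw [hP, riccatiR]
    simp only [L, riccatiFactor, riccatiS, Matrix.mul_sub, Matrix.sub_mul, Matrix.mul_smul,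
      Matrix.smul_mul, Matrix.mul_one]
    abel
  have hΔ0 : F.riccatiR q 0 - P 0 = 0 := by simp [riccatiR, P, controllabilityGramian]
  have hMS : ∀ k < N, L.B k * F.riccatiS q k
      = -(F.A k * F.riccatiR q k * (F.C k)ᵀ + q • (F.B k * (F.D k)ᵀ)) := by
    intro k hk
    simp only [L, riccatiFactor, riccatiStepM, riccatiS] at hS ⊢
    rw [Matrix.mul_assoc, nonsing_inv_mul _ ((isUnit_iff_isUnit_det _).1 (hS k hk)),
      Matrix.mul_one]
  have hF : q • (F.ioMatrix N * (F.ioMatrix N)ᵀ)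
      = F.ioMatrix N * timeBlockDiagonal N (fun _ => q • (1 : Matrix (Fin m) (Fin m) ℝ))
        * (F.ioMatrix N)ᵀ := by
    rw [timeBlockDiagonal_smul_one]; simp
  -- It suffices to compare the blocks on and below the diagonal, as both sides are symmetric.
  have hlower : ∀ x y : Fin (N + 1) × Fin r, y.1 ≤ x.1 →
      (1 - q • (F.ioMatrix N * (F.ioMatrix N)ᵀ) :
          Matrix (Fin (N + 1) × Fin r) (Fin (N + 1) × Fin r) ℝ) x y
        = (L.ioMatrix N * timeBlockDiagonal N (F.riccatiS q) * (L.ioMatrix N)ᵀ) x y := by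
    rintro ⟨j, a⟩ ⟨k, b⟩ hkj
    rw [hF, Matrix.sub_apply, ioMatrix_mul_timeBlockDiagonal_mul_transpose_apply,
      ioMatrix_mul_timeBlockDiagonal_mul_transpose_apply]
    rcases eq_or_lt_of_le hkj with h | h
    · obtain rfl : k = j := h
      dsimp only
      rw [F.sum_block_eq_self _ rfl hP (Nat.lt_succ_iff.1 k.2),
        L.sum_block_eq_self (P := fun k => F.riccatiR q k - P k) _ hΔ0 hΔ (Nat.lt_succ_iff.1 k.2)]
      have : (1 : Matrix (Fin (N + 1) × Fin r) (Fin (N + 1) × Fin r) ℝ) (k, a) (k, b)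
          = (1 : Matrix (Fin r) (Fin r) ℝ) a b := by simp [Matrix.one_apply]
      rw [this, ← Matrix.sub_apply]
      refine congrArg (fun X : Matrix (Fin r) (Fin r) ℝ => X a b) ?_
      simp only [L, riccatiFactor, riccatiS, riccatiStepS, Matrix.mul_sub, Matrix.sub_mul,
        Matrix.mul_smul, Matrix.smul_mul, Matrix.mul_one, Matrix.one_mul, transpose_one]
      abel
    · have hk : (k : ℕ) < j := h
      dsimp only
      rw [F.sum_block_eq_of_lt _ rfl hP (Nat.lt_succ_iff.1 k.2) hk,
        L.sum_block_eq_of_lt (P := fun k => F.riccatiR q k - P k) _ hΔ0 hΔ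
          (Nat.lt_succ_iff.1 k.2) hk, hMS k (by omega)]
      have h1 : (1 : Matrix (Fin (N + 1) × Fin r) (Fin (N + 1) × Fin r) ℝ) (j, a) (k, b) = 0 := by
        simp [h.ne']
      have hL : (F.riccatiFactor q).transition j (k + 1) = F.transition j (k + 1) :=
        F.riccatiFactor_transition q j (k + 1)
      rw [h1, zero_sub, ← Matrix.neg_apply, hL]
      refine congrArg (fun X : Matrix (Fin r) (Fin r) ℝ => X a b) ?_
      simp only [L, riccatiFactor, Matrix.mul_sub, Matrix.sub_mul, transpose_one,
        Matrix.mul_smul, Matrix.smul_mul, Matrix.mul_one, ← Matrix.mul_neg]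
      congr 1
      abel
  ext x y
  rcases le_total y.1 x.1 with h | h
  · exact hlower x y h
  · have h1 : (1 - q • (F.ioMatrix N * (F.ioMatrix N)ᵀ))ᵀ
        = 1 - q • (F.ioMatrix N * (F.ioMatrix N)ᵀ) := by simp
    have h2 : (L.ioMatrix N * timeBlockDiagonal N (F.riccatiS q) * (L.ioMatrix N)ᵀ)ᵀ
        = L.ioMatrix N * timeBlockDiagonal N (F.riccatiS q) * (L.ioMatrix N)ᵀ := by
      have : (timeBlockDiagonal N (F.riccatiS q))ᵀ = timeBlockDiagonal N (F.riccatiS q) := by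
        simp [timeBlockDiagonal, blockDiagonal_transpose, riccatiS_transpose]
      simp [this, Matrix.mul_assoc]
    rw [← h1, ← h2]
    exact hlower y x h

theorem posDef_one_sub_smul_ioMatrix_iff_timeBlockDiagonal (q : ℝ) (N : ℕ)
    (hS : ∀ k < N, IsUnit (F.riccatiS q k)) :
    (1 - q • (F.ioMatrix N * (F.ioMatrix N)ᵀ)).PosDef
      ↔ (timeBlockDiagonal N (F.riccatiS q)).PosDef := by
  rw [F.one_sub_smul_ioMatrix_mul_transpose q N hS, ← conjTranspose_eq_transpose_of_trivial]
  refine IsUnit.posDef_star_right_conjugate_iff ?_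
  rw [isUnit_iff_isUnit_det, det_ioMatrix_of_D_eq_one _ fun _ => rfl]
  exact isUnit_one

theorem posDef_riccatiS_iff (q : ℝ) (N : ℕ) :
    (∀ k ≤ N, (F.riccatiS q k).PosDef) ↔ (1 - q • (F.ioMatrix N * (F.ioMatrix N)ᵀ)).PosDef := by
  constructor
  · intro h
    rw [F.posDef_one_sub_smul_ioMatrix_iff_timeBlockDiagonal q N fun k hk => (h k hk.le).isUnit,
      timeBlockDiagonal_posDef_iff]
    exact h
  · intro h
    -- For `k ≤ N` the matrix for the horizon `k` is a leading principal submatrix.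
    have hlead : ∀ k ≤ N, (1 - q • (F.ioMatrix k * (F.ioMatrix k)ᵀ)).PosDef := by
      intro k hk
      have he : Function.Injective fun x : Fin (k + 1) × Fin r =>
          ((Fin.castLE (Nat.succ_le_succ hk) x.1 : Fin (N + 1)), x.2) := by
        rintro ⟨i, a⟩ ⟨j, b⟩ hij
        simpa using hij
      convert! h.submatrix he using 1
      ext x y
      simp only [submatrix_apply, Matrix.sub_apply, Matrix.smul_apply, Matrix.one_apply, he.eq_iff]
      congr 2
      have hio : ∀ M, F.ioMatrix M * (F.ioMatrix M)ᵀ = F.ioMatrix M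
          * timeBlockDiagonal M (fun _ => (1 : ℝ) • (1 : Matrix (Fin m) (Fin m) ℝ))
          * (F.ioMatrix M)ᵀ := by
        intro M
        rw [timeBlockDiagonal_smul_one, one_smul, Matrix.mul_one]
      rw [hio, hio, ioMatrix_mul_timeBlockDiagonal_mul_transpose_apply,
        ioMatrix_mul_timeBlockDiagonal_mul_transpose_apply]
      dsimp only [Fin.val_castLE]
      refine congrArg (fun X : Matrix (Fin r) (Fin r) ℝ => X x.2 y.2) ?_
      refine Finset.sum_subset (Finset.range_mono (by omega)) fun i _ hi => ?_
      rw [F.block_of_gt (j := x.1) (by have := Finset.mem_range.not.1 hi; omega)]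
      simp
    intro k
    induction k using Nat.strong_induction_on with
    | _ k ih =>
      intro hk
      have h1 := (F.posDef_one_sub_smul_ioMatrix_iff_timeBlockDiagonal q k
        fun i hi => (ih i hi (hi.le.trans hk)).isUnit).1 (hlead k hk)
      exact (timeBlockDiagonal_posDef_iff k _).1 h1 k le_rfl

theorem prod_det_riccatiS (q : ℝ) (N : ℕ) (h : ∀ k ≤ N, (F.riccatiS q k).PosDef) :
    ∏ k ∈ Finset.range (N + 1), (F.riccatiS q k).det
      = (1 - q • ((F.ioMatrix N)ᵀ * F.ioMatrix N)).det := by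
  have hdet := congrArg det
    (F.one_sub_smul_ioMatrix_mul_transpose q N fun k hk => (h k hk.le).isUnit)
  rw [det_mul, det_mul, det_transpose, det_ioMatrix_of_D_eq_one _ (fun _ => rfl),
    det_timeBlockDiagonal, ← Matrix.smul_mul, det_one_sub_mul_comm, Matrix.mul_smul] at hdet
  simpa using hdet.symm

end LDTVSystem

/-! ### Gaussian integrals in an orthonormal basis -/

section GaussianLaw

variable {ι : Type} [Fintype ι]

theorem integrable_exp_neg_half_mul_sq {k : ℝ} (hk : 0 < k) :
    Integrable fun x : ℝ => Real.exp (-(k * x ^ 2) / 2) := by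
  convert! integrable_exp_neg_mul_sq (half_pos hk) using 3
  ring

theorem integral_exp_neg_half_mul_sq (k : ℝ) :
    ∫ x : ℝ, Real.exp (-(k * x ^ 2) / 2) = √(2 * Real.pi / k) := by
  rw [show 2 * Real.pi / k = Real.pi / (k / 2) by field_simp, ← integral_gaussian]
  congr 1
  ext x
  ring_nf

theorem integrable_sq_mul_exp_neg_half_mul_sq {k : ℝ} (hk : 0 < k) :
    Integrable fun x : ℝ => x ^ 2 * Real.exp (-(k * x ^ 2) / 2) := by
  convert! integrable_rpow_mul_exp_neg_mul_sq (half_pos hk) (s := 2) (by norm_num) using 3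
  · norm_num
  · ring_nf

theorem integral_sq_mul_exp_neg_half_mul_sq {k : ℝ} (hk : 0 < k) :
    ∫ x : ℝ, x ^ 2 * Real.exp (-(k * x ^ 2) / 2) = √(2 * Real.pi / k) / k := by
  set v : NNReal := ⟨k⁻¹, (inv_pos.2 hk).le⟩
  have hv : v ≠ 0 := NNReal.coe_ne_zero.1 (inv_pos.2 hk).ne'
  have hvk : (v : ℝ) = k⁻¹ := rfl
  have h := ProbabilityTheory.variance_id_gaussianReal (μ := 0) (v := v)
  rw [ProbabilityTheory.variance_eq_integral (by fun_prop)] at h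
  simp only [id, ProbabilityTheory.integral_id_gaussianReal] at h
  simp only [sub_zero,
    ProbabilityTheory.integral_gaussianReal_eq_integral_smul hv,
    ProbabilityTheory.gaussianPDFReal, smul_eq_mul, mul_assoc, integral_const_mul] at h
  rw [inv_mul_eq_iff_eq_mul₀ (by positivity), hvk] at h
  rw [div_eq_mul_inv, div_eq_mul_inv]
  convert! h using 1
  · refine integral_congr_ae (.of_forall fun x => ?_)
    dsimp only
    rw [mul_comm]
    congr 2
    field_simp
  · ring_nf

/-- The quadratic form with eigenvalues `k i` in the orthonormal basis `b`. -/
noncomputable def diagQuadratic (b : OrthonormalBasis ι ℝ (EuclideanSpace ℝ ι)) (k : ι → ℝ)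
    (w : EuclideanSpace ℝ ι) : ℝ :=
  ∑ i, k i * b.repr w i ^ 2

/-- The (unnormalized) log-density of the centred Gaussian vector whose coordinates in the basis
`b` are independent with variances `1 / k i`. -/
noncomputable def gaussianLogDensity (b : OrthonormalBasis ι ℝ (EuclideanSpace ℝ ι)) (k : ι → ℝ)
    (w : EuclideanSpace ℝ ι) : ℝ :=
  -diagQuadratic b k w / 2

/-- The centred Gaussian law on `ℝ^ι` whose coordinates in the orthonormal basis `b` are
independent with variances `1 / k i`. -/
noncomputable def diagGaussian (b : OrthonormalBasis ι ℝ (EuclideanSpace ℝ ι)) (k : ι → ℝ) :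
    Measure (EuclideanSpace ℝ ι) :=
  volume.tilted (gaussianLogDensity b k)

variable (b : OrthonormalBasis ι ℝ (EuclideanSpace ℝ ι)) {k : ι → ℝ}

/-- The coordinates in an orthonormal basis preserve volume. -/
theorem measurePreserving_ofLp_repr :
    MeasurePreserving (fun w : EuclideanSpace ℝ ι => (b.repr w).ofLp) volume volume :=
  (PiLp.volume_preserving_ofLp ι).comp b.measurePreserving_repr

theorem measurableEmbedding_ofLp_repr :
    MeasurableEmbedding fun w : EuclideanSpace ℝ ι => (b.repr w).ofLp :=
  (MeasurableEquiv.toLp 2 (ι → ℝ)).symm.measurableEmbedding.comp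
    b.repr.toHomeomorph.measurableEmbedding

theorem integrable_prod_repr {f : ι → ℝ → ℝ} (hf : ∀ i, Integrable (f i)) :
    Integrable fun w : EuclideanSpace ℝ ι => ∏ i, f i (b.repr w i) :=
  (measurePreserving_ofLp_repr b).integrable_comp_of_integrable (Integrable.fintype_prod hf)

theorem integral_prod_repr (f : ι → ℝ → ℝ) :
    ∫ w : EuclideanSpace ℝ ι, ∏ i, f i (b.repr w i) = ∏ i, ∫ x, f i x := by
  rw [← integral_fintype_prod_volume_eq_prod]
  exact (measurePreserving_ofLp_repr b).integral_comp (measurableEmbedding_ofLp_repr b)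
    (fun x : ι → ℝ => ∏ i, f i (x i))

theorem exp_gaussianLogDensity (k : ι → ℝ) (w : EuclideanSpace ℝ ι) :
    Real.exp (gaussianLogDensity b k w) = ∏ i, Real.exp (-(k i * b.repr w i ^ 2) / 2) := by
  rw [← Real.exp_sum, gaussianLogDensity, diagQuadratic, ← Finset.sum_div, Finset.sum_neg_distrib]

theorem integrable_exp_gaussianLogDensity (hk : ∀ i, 0 < k i) :
    Integrable fun w => Real.exp (gaussianLogDensity b k w) := by
  simp only [exp_gaussianLogDensity]
  exact integrable_prod_repr b fun i => integrable_exp_neg_half_mul_sq (hk i)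

theorem integral_exp_gaussianLogDensity (k : ι → ℝ) :
    ∫ w, Real.exp (gaussianLogDensity b k w) = ∏ i, √(2 * Real.pi / k i) := by
  simp only [exp_gaussianLogDensity]
  rw [integral_prod_repr b fun i x => Real.exp (-(k i * x ^ 2) / 2)]
  simp only [integral_exp_neg_half_mul_sq]

theorem exp_gaussianLogDensity_mul_sq [DecidableEq ι] (k : ι → ℝ) (j : ι)
    (w : EuclideanSpace ℝ ι) :
    Real.exp (gaussianLogDensity b k w) * b.repr w j ^ 2
      = ∏ i, (if i = j then b.repr w i ^ 2 else 1) * Real.exp (-(k i * b.repr w i ^ 2) / 2) := by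
  rw [Finset.prod_mul_distrib, exp_gaussianLogDensity, mul_comm]
  simp

theorem integrable_exp_gaussianLogDensity_mul_sq (hk : ∀ i, 0 < k i) (j : ι) :
    Integrable fun w => Real.exp (gaussianLogDensity b k w) * b.repr w j ^ 2 := by
  classical
  simp only [exp_gaussianLogDensity_mul_sq]
  refine integrable_prod_repr b
    (f := fun i x => (if i = j then x ^ 2 else 1) * Real.exp (-(k i * x ^ 2) / 2)) fun i => ?_
  by_cases hij : i = j
  · simpa [hij] using integrable_sq_mul_exp_neg_half_mul_sq (hk j)
  · simpa [hij] using integrable_exp_neg_half_mul_sq (hk i)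

theorem integral_exp_gaussianLogDensity_mul_sq (hk : ∀ i, 0 < k i) (j : ι) :
    ∫ w, Real.exp (gaussianLogDensity b k w) * b.repr w j ^ 2
      = (∏ i, √(2 * Real.pi / k i)) / k j := by
  classical
  simp only [exp_gaussianLogDensity_mul_sq]
  rw [integral_prod_repr b
    fun i x => (if i = j then x ^ 2 else 1) * Real.exp (-(k i * x ^ 2) / 2)]
  have h : ∀ i, ∫ x : ℝ, (if i = j then x ^ 2 else 1) * Real.exp (-(k i * x ^ 2) / 2)
      = √(2 * Real.pi / k i) * if i = j then (k j)⁻¹ else 1 := by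
    intro i
    by_cases hij : i = j
    · subst hij
      simp only [if_true, integral_sq_mul_exp_neg_half_mul_sq (hk _)]
      exact div_eq_mul_inv _ _
    · simp [hij, integral_exp_neg_half_mul_sq]
  simp only [h, Finset.prod_mul_distrib]
  simp [div_eq_mul_inv]

theorem norm_sq_eq_sum_repr_sq (w : EuclideanSpace ℝ ι) : ‖w‖ ^ 2 = ∑ i, b.repr w i ^ 2 := by
  rw [← b.repr.norm_map w, EuclideanSpace.real_norm_sq_eq]

theorem isProbabilityMeasure_diagGaussian (hk : ∀ i, 0 < k i) :
    IsProbabilityMeasure (diagGaussian b k) :=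
  isProbabilityMeasure_tilted (integrable_exp_gaussianLogDensity b hk)

theorem integrable_repr_sq_diagGaussian (hk : ∀ i, 0 < k i) (j : ι) :
    Integrable (fun w => b.repr w j ^ 2) (diagGaussian b k) :=
  (integrable_tilted_iff (integrable_exp_gaussianLogDensity b hk) _).2
    (integrable_exp_gaussianLogDensity_mul_sq b hk j)

theorem integral_repr_sq_diagGaussian (hk : ∀ i, 0 < k i) (j : ι) :
    ∫ w, b.repr w j ^ 2 ∂diagGaussian b k = 1 / k j := by
  have hpos : 0 < ∏ i, √(2 * Real.pi / k i) :=
    Finset.prod_pos fun i _ => Real.sqrt_pos.2 (by have := hk i; positivity)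
  rw [diagGaussian, integral_tilted]
  simp only [smul_eq_mul, div_mul_eq_mul_div]
  rw [integral_div, integral_exp_gaussianLogDensity_mul_sq b hk, integral_exp_gaussianLogDensity]
  field_simp

theorem scalarGaussian_eq_diagGaussian {v : ℝ} (hv : 0 < v) :
    scalarGaussian ι v = diagGaussian b fun _ => 1 / v := by
  rw [scalarGaussian, diagGaussian, Measure.tilted, integral_exp_gaussianLogDensity]
  congr 1
  ext w
  congr 1
  rw [scalarGaussianPDF, gaussianLogDensity, diagQuadratic, ← Finset.mul_sum,
    ← norm_sq_eq_sum_repr_sq, Finset.prod_const, Finset.card_univ, mul_comm,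
    div_eq_mul_inv (Real.exp _)]
  congr 1
  · congr 1
    field_simp
  · rw [neg_div, Real.rpow_neg (by positivity), Real.sqrt_eq_rpow, ← Real.rpow_natCast,
      ← Real.rpow_mul (by positivity)]
    congr 2
    · field_simp
    · ring

theorem isL2ACLaw_diagGaussian (hk : ∀ i, 0 < k i) : IsL2ACLaw (diagGaussian b k) where
  isProbabilityMeasure := isProbabilityMeasure_diagGaussian b hk
  absolutelyContinuous := tilted_absolutelyContinuous _ _
  squareIntegrable := by
    rw [memLp_two_iff_integrable_sq_norm (by fun_prop)]
    simp only [norm_sq_eq_sum_repr_sq b]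
    exact integrable_finsetSum _ fun i _ => integrable_repr_sq_diagGaussian b hk i

theorem IsL2ACLaw.integrable_repr_sq {μ : Measure (EuclideanSpace ℝ ι)} (hμ : IsL2ACLaw μ)
    (i : ι) : Integrable (fun w => b.repr w i ^ 2) μ := by
  refine ((memLp_two_iff_integrable_sq_norm (by fun_prop)).1 hμ.squareIntegrable).mono'
    (by fun_prop) (.of_forall fun w => ?_)
  rw [norm_sq_eq_sum_repr_sq b, Real.norm_of_nonneg (sq_nonneg _)]
  exact Finset.single_le_sum (f := fun i => b.repr w i ^ 2) (fun i _ => sq_nonneg _)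
    (Finset.mem_univ i)

theorem IsL2ACLaw.integral_diagQuadratic {μ : Measure (EuclideanSpace ℝ ι)} (hμ : IsL2ACLaw μ)
    (k : ι → ℝ) :
    ∫ w, diagQuadratic b k w ∂μ = ∑ i, k i * ∫ w, b.repr w i ^ 2 ∂μ := by
  simp only [diagQuadratic]
  rw [integral_finsetSum _ fun i _ => (hμ.integrable_repr_sq b i).const_mul (k i)]
  simp only [integral_const_mul]

theorem IsL2ACLaw.integrable_gaussianLogDensity {μ : Measure (EuclideanSpace ℝ ι)}
    (hμ : IsL2ACLaw μ) (k : ι → ℝ) : Integrable (gaussianLogDensity b k) μ :=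
  (integrable_finsetSum _ fun i _ => (hμ.integrable_repr_sq b i).const_mul (k i)).neg.div_const 2

end GaussianLaw

/-! ### Relative entropy with respect to Gaussian laws -/

section AnisotropicNorm

/-- The Donsker–Varadhan lower bound for the relative entropy. It says that the relative entropy of
`μ` with respect to the tilted law `ν.tilted f` is nonnegative. -/
theorem integral_sub_log_le_toReal_klDiv {α : Type*} [MeasurableSpace α] {μ ν : Measure α}
    [IsProbabilityMeasure μ] [IsProbabilityMeasure ν] {f : α → ℝ} (hfμ : Integrable f μ)
    (hfν : Integrable (fun x => Real.exp (f x)) ν) (h : InformationTheory.klDiv μ ν ≠ ∞) :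
    ∫ x, f x ∂μ - Real.log (∫ x, Real.exp (f x) ∂ν) ≤ (InformationTheory.klDiv μ ν).toReal := by
  obtain ⟨hac, hint⟩ := InformationTheory.klDiv_ne_top_iff.1 h
  have := isProbabilityMeasure_tilted hfν
  have hnn := InformationTheory.integral_llr_add_sub_measure_univ_nonneg
    (hac.trans (absolutelyContinuous_tilted hfν))
    (integrable_llr_tilted_right hac hfμ hint hfν)
  rw [integral_llr_tilted_right hac hfμ hfν hint] at hnn
  rw [InformationTheory.toReal_klDiv_of_measure_eq hac (by simp)]
  simp only [probReal_univ] at hnn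
  linarith

variable {ι : Type} [Fintype ι] (b : OrthonormalBasis ι ℝ (EuclideanSpace ℝ ι)) {k k₀ : ι → ℝ}

theorem gaussianLogDensity_add_sub (k k₀ : ι → ℝ) :
    gaussianLogDensity b k₀ + (gaussianLogDensity b k - gaussianLogDensity b k₀)
      = gaussianLogDensity b k := by
  abel

theorem integrable_exp_gaussianLogDensity_sub (hk : ∀ i, 0 < k i) (hk₀ : ∀ i, 0 < k₀ i) :
    Integrable (fun w => Real.exp ((gaussianLogDensity b k - gaussianLogDensity b k₀) w))
      (diagGaussian b k₀) := by
  rw [diagGaussian, integrable_tilted_iff (integrable_exp_gaussianLogDensity b hk₀)]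
  convert! integrable_exp_gaussianLogDensity b hk using 2 with w
  rw [smul_eq_mul, ← Real.exp_add, ← Pi.add_apply, gaussianLogDensity_add_sub]

theorem diagGaussian_eq_tilted (k : ι → ℝ) (hk₀ : ∀ i, 0 < k₀ i) :
    diagGaussian b k
      = (diagGaussian b k₀).tilted (gaussianLogDensity b k - gaussianLogDensity b k₀) := by
  rw [diagGaussian, diagGaussian, tilted_tilted (integrable_exp_gaussianLogDensity b hk₀),
    gaussianLogDensity_add_sub]

theorem log_integral_exp_gaussianLogDensity_sub (hk : ∀ i, 0 < k i) (hk₀ : ∀ i, 0 < k₀ i) :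
    Real.log (∫ w, Real.exp ((gaussianLogDensity b k - gaussianLogDensity b k₀) w)
      ∂diagGaussian b k₀) = (∑ i, (Real.log (k₀ i) - Real.log (k i))) / 2 := by
  have hlog : ∀ {k : ι → ℝ}, (∀ i, 0 < k i) → Real.log (∏ i, √(2 * Real.pi / k i))
      = ∑ i, (Real.log (2 * Real.pi) - Real.log (k i)) / 2 := by
    intro k hk
    have hpos : ∀ i, 0 < 2 * Real.pi / k i := fun i => by have := hk i; positivity
    rw [Real.log_prod fun i _ => (Real.sqrt_pos.2 (hpos i)).ne']
    refine Finset.sum_congr rfl fun i _ => ?_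
    rw [Real.log_sqrt (hpos i).le, Real.log_div (by positivity) (hk i).ne']
  have hne : ∀ {k : ι → ℝ}, (∀ i, 0 < k i) → ∏ i, √(2 * Real.pi / k i) ≠ 0 := fun hk =>
    Finset.prod_ne_zero_iff.2 fun i _ =>
      (Real.sqrt_pos.2 (by have := hk i; positivity)).ne'
  rw [diagGaussian, integral_exp_tilted, gaussianLogDensity_add_sub,
    integral_exp_gaussianLogDensity, integral_exp_gaussianLogDensity,
    Real.log_div (hne hk) (hne hk₀), hlog hk, hlog hk₀, ← Finset.sum_sub_distrib, Finset.sum_div]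
  exact Finset.sum_congr rfl fun i _ => by ring

theorem IsL2ACLaw.integral_gaussianLogDensity_sub {μ : Measure (EuclideanSpace ℝ ι)}
    (hμ : IsL2ACLaw μ) (k k₀ : ι → ℝ) :
    ∫ w, (gaussianLogDensity b k - gaussianLogDensity b k₀) w ∂μ
      = (∑ i, (k₀ i - k i) * ∫ w, b.repr w i ^ 2 ∂μ) / 2 := by
  simp only [Pi.sub_apply]
  rw [integral_sub (hμ.integrable_gaussianLogDensity b k) (hμ.integrable_gaussianLogDensity b k₀)]
  simp only [gaussianLogDensity, integral_div, integral_neg, hμ.integral_diagQuadratic, sub_mul,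
    Finset.sum_sub_distrib]
  ring

theorem IsL2ACLaw.le_toReal_klDiv_diagGaussian {μ : Measure (EuclideanSpace ℝ ι)}
    (hμ : IsL2ACLaw μ) (hk : ∀ i, 0 < k i) (hk₀ : ∀ i, 0 < k₀ i)
    (h : InformationTheory.klDiv μ (diagGaussian b k₀) ≠ ∞) :
    (∑ i, (k₀ i - k i) * ∫ w, b.repr w i ^ 2 ∂μ) / 2
        - (∑ i, (Real.log (k₀ i) - Real.log (k i))) / 2
      ≤ (InformationTheory.klDiv μ (diagGaussian b k₀)).toReal := by
  have := hμ.isProbabilityMeasure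
  have := isProbabilityMeasure_diagGaussian b hk₀
  rw [← log_integral_exp_gaussianLogDensity_sub b hk hk₀, ← hμ.integral_gaussianLogDensity_sub b]
  exact integral_sub_log_le_toReal_klDiv
    ((hμ.integrable_gaussianLogDensity b k).sub (hμ.integrable_gaussianLogDensity b k₀))
    (integrable_exp_gaussianLogDensity_sub b hk hk₀) h

theorem klDiv_diagGaussian (hk : ∀ i, 0 < k i) (hk₀ : ∀ i, 0 < k₀ i) :
    InformationTheory.klDiv (diagGaussian b k) (diagGaussian b k₀)
      = ENNReal.ofReal ((∑ i, (k₀ i - k i) / k i) / 2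
        - (∑ i, (Real.log (k₀ i) - Real.log (k i))) / 2) := by
  have := isProbabilityMeasure_diagGaussian b hk
  have := isProbabilityMeasure_diagGaussian b hk₀
  have hL := isL2ACLaw_diagGaussian b hk
  have hac : diagGaussian b k ≪ diagGaussian b k₀ := by
    rw [diagGaussian_eq_tilted b k hk₀]
    exact tilted_absolutelyContinuous _ _
  have hllr : llr (diagGaussian b k) (diagGaussian b k₀) =ᵐ[diagGaussian b k]
      fun w => (gaussianLogDensity b k - gaussianLogDensity b k₀) w
        - Real.log (∫ w, Real.exp ((gaussianLogDensity b k - gaussianLogDensity b k₀) w)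
            ∂diagGaussian b k₀) := by
    refine hac.ae_le ?_
    have h := log_rnDeriv_tilted_left_self (integrable_exp_gaussianLogDensity_sub b hk hk₀)
    rwa [← diagGaussian_eq_tilted b k hk₀] at h
  have hint : Integrable (gaussianLogDensity b k - gaussianLogDensity b k₀) (diagGaussian b k) :=
    (hL.integrable_gaussianLogDensity b k).sub (hL.integrable_gaussianLogDensity b k₀)
  rw [InformationTheory.klDiv_of_ac_of_integrable hac
    ((hint.sub (integrable_const _)).congr hllr.symm), integral_congr_ae hllr,
    integral_sub hint (integrable_const _), log_integral_exp_gaussianLogDensity_sub b hk hk₀,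
    hL.integral_gaussianLogDensity_sub b]
  simp [integral_repr_sq_diagGaussian b hk, div_eq_mul_inv]

/-! ### The anisotropic norm in terms of eigenvalues -/

/-- With `k₀ i = 1 / v`, the bound `le_toReal_klDiv_diagGaussian` minimized over `v > 0`. The
minimum is attained at `v = E|W|² / ℓ`. -/
theorem IsL2ACLaw.le_anisotropy [Nonempty ι] {μ : Measure (EuclideanSpace ℝ ι)}
    (hμ : IsL2ACLaw μ) (hY : 0 < ∫ w, ‖w‖ ^ 2 ∂μ) (hk : ∀ i, 0 < k i) :
    ENNReal.ofReal ((Fintype.card ι - ∑ i, k i * ∫ w, b.repr w i ^ 2 ∂μ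
      + Fintype.card ι * Real.log ((∫ w, ‖w‖ ^ 2 ∂μ) / Fintype.card ι)
      + ∑ i, Real.log (k i)) / 2) ≤ anisotropy μ := by
  refine le_iInf₂ fun v hv => ?_
  rw [scalarGaussian_eq_diagGaussian b hv]
  by_cases h : InformationTheory.klDiv μ (diagGaussian b fun _ => 1 / v) = ∞
  · rw [h]; exact le_top
  refine ENNReal.ofReal_le_of_le_toReal (le_trans ?_
    (hμ.le_toReal_klDiv_diagGaussian b hk (fun _ => one_div_pos.2 hv) h))
  have hYsum : ∫ w, ‖w‖ ^ 2 ∂μ = ∑ i, ∫ w, b.repr w i ^ 2 ∂μ := by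
    simp only [norm_sq_eq_sum_repr_sq b]
    exact integral_finsetSum _ fun i _ => hμ.integrable_repr_sq b i
  set Y := ∫ w, ‖w‖ ^ 2 ∂μ
  set l : ℝ := (Fintype.card ι : ℝ)
  have hl : 0 < l := by simp [l, Fintype.card_pos]
  have hlog := Real.log_le_sub_one_of_pos (x := Y / l / v) (by positivity)
  rw [Real.log_div (by positivity) hv.ne'] at hlog
  have hlog' := mul_le_mul_of_nonneg_left hlog hl.le
  have he : l * (Y / l / v - 1) = Y / v - l := by field_simp
  rw [he] at hlog'
  simp only [sub_mul, Finset.sum_sub_distrib, ← Finset.mul_sum, ← hYsum, Finset.sum_const,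
    Finset.card_univ, nsmul_eq_mul, one_div, Real.log_inv]
  have : v⁻¹ * Y = Y / v := by ring
  rw [this]
  linarith

variable {σ : Type} [Fintype σ] [DecidableEq ι] {F : Matrix σ ι ℝ} {g : ι → ℝ} {a γ : ℝ}

theorem anisotropicNorm_le_of_log_le [Nonempty ι] (ha : 0 < a) (hγ : 0 ≤ γ)
    (hF : ∀ w, ‖Matrix.toEuclideanLin F w‖ ^ 2 = diagQuadratic b g w) {q : ℝ} (hq : 0 ≤ q)
    (hqγ : q * γ ^ 2 < 1) (hqg : ∀ i, 0 < 1 - q * g i)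
    (hlog : Fintype.card ι * Real.log (1 - q * γ ^ 2) + 2 * a ≤ ∑ i, Real.log (1 - q * g i)) :
    anisotropicNorm F a ≤ ENNReal.ofReal γ := by
  refine iSup₂_le fun μ hμ => iSup_le fun hA => ENNReal.ofReal_le_ofReal ?_
  by_contra! hlt
  rw [rmsGain, Real.lt_sqrt hγ] at hlt
  simp only [hF, hμ.integral_diagQuadratic b] at hlt
  set Y := ∫ w, ‖w‖ ^ 2 ∂μ with hYdef
  set X := ∑ i, g i * ∫ w, b.repr w i ^ 2 ∂μ with hX
  have hY0 : 0 ≤ Y := integral_nonneg fun w => by positivity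
  have hY : 0 < Y := by
    refine hY0.lt_of_ne fun h => ?_
    rw [← h, div_zero] at hlt
    exact absurd hlt (not_lt.2 (sq_nonneg γ))
  have hYsum : Y = ∑ i, ∫ w, b.repr w i ^ 2 ∂μ := by
    simp only [hYdef, norm_sq_eq_sum_repr_sq b]
    exact integral_finsetSum _ fun i _ => hμ.integrable_repr_sq b i
  rw [lt_div_iff₀ hY] at hlt
  have hq' : 0 < q := by
    refine hq.lt_of_ne fun h => ?_
    subst h
    simp at hlog
    linarith
  set l : ℝ := (Fintype.card ι : ℝ)
  have hl : 0 < l := by simp [l, Fintype.card_pos]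
  have hd : 0 < 1 - q * γ ^ 2 := by linarith
  -- Test against the Gaussian law with precision matrix proportional to `1 - q FᵀF`, scaled so
  -- that the bound is at least `a` for an input with gain `γ` and second moment `Y`, and exceeds
  -- `a` for a larger gain.
  have hle := (hμ.le_anisotropy b hY (k := fun i => l / Y * ((1 - q * g i) / (1 - q * γ ^ 2)))
    fun i => by have := hqg i; positivity).trans hA
  rw [ENNReal.ofReal_le_ofReal_iff ha.le] at hle
  have h1 : ∑ i, l / Y * ((1 - q * g i) / (1 - q * γ ^ 2)) * ∫ w, b.repr w i ^ 2 ∂μ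
      = l / Y / (1 - q * γ ^ 2) * (Y - q * X) := by
    rw [hX, hYsum, Finset.mul_sum, ← Finset.sum_sub_distrib, Finset.mul_sum, ← hYsum]
    exact Finset.sum_congr rfl fun i _ => by ring
  have h2 : ∑ i, Real.log (l / Y * ((1 - q * g i) / (1 - q * γ ^ 2)))
      = -(l * Real.log (Y / l)) + ∑ i, Real.log (1 - q * g i) - l * Real.log (1 - q * γ ^ 2) := by
    have : ∀ i, Real.log (l / Y * ((1 - q * g i) / (1 - q * γ ^ 2)))
        = -Real.log (Y / l) + Real.log (1 - q * g i) - Real.log (1 - q * γ ^ 2) := fun i => by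
      rw [Real.log_mul (by positivity) (div_pos (hqg i) hd).ne',
        Real.log_div (hqg i).ne' hd.ne', ← Real.log_inv, inv_div]
      ring
    simp only [this, Finset.sum_sub_distrib, Finset.sum_add_distrib, Finset.sum_const,
      Finset.card_univ, nsmul_eq_mul]
    simp only [l]
    ring
  rw [h1, h2] at hle
  have h3 : l / Y / (1 - q * γ ^ 2) * (Y - q * X) < l := by
    rw [div_div, div_mul_eq_mul_div, div_lt_iff₀ (by positivity)]
    have := mul_lt_mul_of_pos_left hlt hq'
    nlinarith
  linarith

/-- The converse estimate: `diagGaussian b k` is an admissible input as soon as its anisotropy,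
computed with the optimal variance `v = (∑ 1 / k i) / ℓ`, is at most `a`. -/
theorem sum_div_le_of_anisotropicNorm_le [Nonempty ι] (hγ : 0 ≤ γ)
    (hF : ∀ w, ‖Matrix.toEuclideanLin F w‖ ^ 2 = diagQuadratic b g w)
    (h : anisotropicNorm F a ≤ ENNReal.ofReal γ) (hk : ∀ i, 0 < k i)
    (hka : ∑ i, Real.log (k i) + Fintype.card ι * Real.log ((∑ i, 1 / k i) / Fintype.card ι)
      ≤ 2 * a) :
    ∑ i, g i / k i ≤ γ ^ 2 * ∑ i, 1 / k i := by
  have hL := isL2ACLaw_diagGaussian b hk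
  set l : ℝ := (Fintype.card ι : ℝ)
  have hl : 0 < l := by simp [l, Fintype.card_pos]
  have hY : 0 < ∑ i, 1 / k i :=
    Finset.sum_pos (fun i _ => one_div_pos.2 (hk i)) Finset.univ_nonempty
  set Y := ∑ i, 1 / k i with hYdef
  have hA : anisotropy (diagGaussian b k) ≤ ENNReal.ofReal a := by
    refine (iInf₂_le (Y / l) (by positivity)).trans ?_
    rw [scalarGaussian_eq_diagGaussian b (by positivity),
      klDiv_diagGaussian b hk fun _ => by positivity]
    refine ENNReal.ofReal_le_ofReal ?_
    have h1 : ∑ i, (1 / (Y / l) - k i) / k i = 0 := by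
      have : ∀ i, (1 / (Y / l) - k i) / k i = l / Y * (1 / k i) - 1 := fun i => by
        have := (hk i).ne'
        field_simp
      simp only [this, Finset.sum_sub_distrib, ← Finset.mul_sum, ← hYdef, Finset.sum_const,
        Finset.card_univ, nsmul_eq_mul]
      simp only [l] at *
      field_simp
      simp
    rw [h1]
    simp only [one_div, Real.log_inv, Finset.sum_sub_distrib, Finset.sum_const,
      Finset.card_univ, nsmul_eq_mul]
    linarith
  have h2 := (le_iSup_of_le (diagGaussian b k) (le_iSup_of_le hL (le_iSup_of_le hA le_rfl))).trans h
  rw [ENNReal.ofReal_le_ofReal_iff hγ, rmsGain, Real.sqrt_le_left hγ] at h2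
  have h3 : ∫ w, ‖w‖ ^ 2 ∂diagGaussian b k = Y := by
    simp only [norm_sq_eq_sum_repr_sq b]
    rw [integral_finsetSum _ fun i _ => hL.integrable_repr_sq b i]
    simp only [integral_repr_sq_diagGaussian b hk, hYdef]
  simp only [hF, hL.integral_diagQuadratic b, integral_repr_sq_diagGaussian b hk, h3] at h2
  rw [div_le_iff₀ hY] at h2
  simpa only [mul_one_div] using h2

end AnisotropicNorm

section NormBound

/-- For nonconstant `g` the left-hand side is twice the anisotropy of the Gaussian law with
precision matrix `1 - q FᵀF`. It vanishes at `q = 0` and is unbounded as `q` approaches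
`1 / max g`. -/
theorem exists_gaussian_anisotropy_eq {ι : Type} [Fintype ι] [Nonempty ι] {g : ι → ℝ} {a : ℝ}
    (ha : 0 < a) (hg : ∀ i, 0 ≤ g i) {i₀ j : ι} (hmax : ∀ i, g i ≤ g i₀) (hj : g j < g i₀) :
    ∃ q : ℝ, 0 ≤ q ∧ q * g i₀ < 1 ∧
      ∑ i, Real.log (1 - q * g i)
        + Fintype.card ι * Real.log ((∑ i, 1 / (1 - q * g i)) / Fintype.card ι) = 2 * a := by
  set l : ℝ := (Fintype.card ι : ℝ) with hldef
  have hl1 : 1 ≤ l := by simp [l, Nat.one_le_iff_ne_zero]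
  have hl : 0 < l := by linarith
  have hM : 0 < g i₀ := (hg j).trans_lt hj
  set δ := 1 - g j / g i₀ with hδdef
  have hδ : 0 < δ := by rw [hδdef, sub_pos, div_lt_one hM]; exact hj
  have hδ1 : δ ≤ 1 := by have := div_nonneg (hg j) hM.le; linarith
  have hlog : 0 ≤ l * Real.log l := mul_nonneg hl.le (Real.log_nonneg hl1)
  -- At the endpoint `q₁` the smallest eigenvalue of `1 - q₁ FᵀF` is `ε`, chosen so small that the
  -- eigenvalue belonging to `g j`, which is at least `δ`, pushes the value above `2 a`.
  set ε := δ * Real.exp (-(2 * a + l * Real.log l)) with hεdef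
  have hε : 0 < ε := by positivity
  have hε1 : ε ≤ 1 := mul_le_one₀ hδ1 (Real.exp_pos _).le (Real.exp_le_one_iff.2 (by linarith))
  set q₁ := (1 - ε) / g i₀ with hq₁def
  have hq₁ : 0 ≤ q₁ := div_nonneg (by linarith) hM.le
  have hq₁M : q₁ * g i₀ = 1 - ε := div_mul_cancel₀ _ hM.ne'
  have hpos : ∀ q ∈ Set.Icc 0 q₁, ∀ i, ε ≤ 1 - q * g i := by
    intro q hq i
    have h1 : q * g i ≤ q₁ * g i₀ := mul_le_mul hq.2 (hmax i) (hg i) hq₁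
    linarith
  have hcont : ContinuousOn (fun q : ℝ => ∑ i, Real.log (1 - q * g i)
      + l * Real.log ((∑ i, 1 / (1 - q * g i)) / l)) (Set.Icc 0 q₁) := by
    have h1 : ∀ i, ContinuousOn (fun q : ℝ => 1 - q * g i) (Set.Icc 0 q₁) := fun i => by fun_prop
    have hne : ∀ i, ∀ q ∈ Set.Icc 0 q₁, 1 - q * g i ≠ 0 := fun i q hq =>
      (hε.trans_le (hpos q hq i)).ne'
    refine (continuousOn_finsetSum _ fun i _ => (h1 i).log (hne i)).add
      (continuousOn_const.mul (ContinuousOn.log ((continuousOn_finsetSum _ fun i _ =>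
        continuousOn_const.div (h1 i) (hne i)).div_const _) fun q hq => ?_))
    exact (div_pos (Finset.sum_pos (fun i _ => one_div_pos.2 (hε.trans_le (hpos q hq i)))
      Finset.univ_nonempty) hl).ne'
  have hleft : ∑ i, Real.log (1 - 0 * g i)
      + l * Real.log ((∑ i, 1 / (1 - 0 * g i)) / l) = 0 := by
    simp [hldef]
  have hright : 2 * a ≤ ∑ i, Real.log (1 - q₁ * g i)
      + l * Real.log ((∑ i, 1 / (1 - q₁ * g i)) / l) := by
    have hmem : q₁ ∈ Set.Icc 0 q₁ := ⟨hq₁, le_rfl⟩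
    have h1 : 1 / ε ≤ ∑ i, 1 / (1 - q₁ * g i) := by
      have := Finset.single_le_sum (f := fun i => 1 / (1 - q₁ * g i))
        (fun i _ => one_div_nonneg.2 (hε.le.trans (hpos q₁ hmem i))) (Finset.mem_univ i₀)
      simpa [hq₁M] using this
    have h2 : -Real.log ε - Real.log l ≤ Real.log ((∑ i, 1 / (1 - q₁ * g i)) / l) := by
      rw [← Real.log_inv, ← Real.log_div (by positivity) hl.ne', ← one_div]
      exact Real.log_le_log (by positivity) (by gcongr)
    have h3 : Real.log δ - Real.log ε ≤ ∑ i, (Real.log (1 - q₁ * g i) - Real.log ε) := by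
      refine le_trans ?_ (Finset.single_le_sum
        (f := fun i => Real.log (1 - q₁ * g i) - Real.log ε)
        (fun i _ => sub_nonneg.2 (Real.log_le_log hε (hpos q₁ hmem i))) (Finset.mem_univ j))
      refine sub_le_sub_right (Real.log_le_log hδ ?_) _
      have : q₁ * g j ≤ 1 / g i₀ * g j :=
        mul_le_mul_of_nonneg_right (div_le_div_of_nonneg_right (by linarith) hM.le) (hg j)
      rw [hδdef, div_eq_mul_one_div, mul_comm (g j)]
      linarith
    have h4 : Real.log ε = Real.log δ - (2 * a + l * Real.log l) := by
      rw [hεdef, Real.log_mul hδ.ne' (Real.exp_pos _).ne', Real.log_exp]; ring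
    rw [Finset.sum_sub_distrib, Finset.sum_const, Finset.card_univ, nsmul_eq_mul] at h3
    have h5 := mul_le_mul_of_nonneg_left h2 hl.le
    linarith
  obtain ⟨q, hq, hqeq⟩ := intermediate_value_Icc hq₁ hcont ⟨by rw [hleft]; linarith, hright⟩
  exact ⟨q, hq.1, by linarith [hpos q hq i₀], hqeq⟩

variable {ι : Type} [Fintype ι] (b : OrthonormalBasis ι ℝ (EuclideanSpace ℝ ι))
  {σ : Type} [Fintype σ] [DecidableEq ι] {F : Matrix σ ι ℝ} {g : ι → ℝ} {a γ : ℝ}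

theorem exists_log_le_of_anisotropicNorm_le [Nonempty ι] (ha : 0 < a) (hγ : 0 ≤ γ)
    (hF : ∀ w, ‖Matrix.toEuclideanLin F w‖ ^ 2 = diagQuadratic b g w) (hg : ∀ i, 0 ≤ g i)
    (hne : ∃ i, g i ≠ γ ^ 2) (h : anisotropicNorm F a ≤ ENNReal.ofReal γ) :
    ∃ q : ℝ, 0 ≤ q ∧ q * γ ^ 2 < 1 ∧ (∀ i, 0 < 1 - q * g i) ∧
      Fintype.card ι * Real.log (1 - q * γ ^ 2) + 2 * a ≤ ∑ i, Real.log (1 - q * g i) := by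
  set l : ℝ := (Fintype.card ι : ℝ) with hldef
  have hl : 0 < l := by simp [l, Fintype.card_pos]
  obtain ⟨i₀, -, hmax⟩ := Finset.exists_max_image Finset.univ g Finset.univ_nonempty
  simp only [Finset.mem_univ, true_imp_iff] at hmax
  rcases lt_or_ge (g i₀) (γ ^ 2) with hlt | hge
  · -- All gains are below `γ`: as `q` tends to `1 / γ²`, the left-hand side tends to `-∞`, while
    -- the right-hand side stays bounded below.
    have hγ2 : 0 < γ ^ 2 := (hg i₀).trans_lt hlt
    have hδ : ∀ i, 0 < 1 - g i / γ ^ 2 := fun i => by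
      rw [sub_pos, div_lt_one hγ2]; exact (hmax i).trans_lt hlt
    have hsum : ∑ i, Real.log (1 - g i / γ ^ 2) ≤ 0 := Finset.sum_nonpos fun i _ =>
      Real.log_nonpos (hδ i).le (by have := div_nonneg (hg i) hγ2.le; linarith)
    set ε := Real.exp ((∑ i, Real.log (1 - g i / γ ^ 2) - 2 * a) / l) with hεdef
    have hε : 0 < ε := Real.exp_pos _
    have hε1 : ε ≤ 1 := Real.exp_le_one_iff.2 (div_nonpos_of_nonpos_of_nonneg (by linarith) hl.le)
    have hq : (1 - ε) / γ ^ 2 * γ ^ 2 = 1 - ε := div_mul_cancel₀ _ hγ2.ne'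
    have hle : ∀ i, 1 - g i / γ ^ 2 ≤ 1 - (1 - ε) / γ ^ 2 * g i := fun i => by
      have : (1 - ε) / γ ^ 2 * g i ≤ 1 / γ ^ 2 * g i :=
        mul_le_mul_of_nonneg_right (div_le_div_of_nonneg_right (by linarith) hγ2.le) (hg i)
      rw [div_eq_mul_one_div, mul_comm (g i)]
      linarith
    refine ⟨(1 - ε) / γ ^ 2, div_nonneg (by linarith) hγ2.le, by linarith,
      fun i => (hδ i).trans_le (hle i), ?_⟩
    rw [hq, sub_sub_cancel, hεdef, Real.log_exp, mul_div_cancel₀ _ hl.ne', sub_add_cancel]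
    exact Finset.sum_le_sum fun i _ => Real.log_le_log (hδ i) (hle i)
  · have hex : ∃ j, g j < g i₀ := by
      -- If `FᵀF` is scalar, the standard Gaussian input already has gain `√(g i₀) > γ`.
      by_contra! hall
      have hconst : ∀ i, g i = g i₀ := fun i => le_antisymm (hmax i) (hall i)
      have h1 := sum_div_le_of_anisotropicNorm_le b hγ hF h (k := fun _ => 1)
        (fun _ => one_pos) (by simpa [hldef] using ha.le)
      simp only [hconst, div_one, Finset.sum_const, Finset.card_univ, nsmul_eq_mul, mul_one,
        ← hldef] at h1
      rw [mul_comm] at h1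
      obtain ⟨i, hi⟩ := hne
      exact hi ((hconst i).trans (le_antisymm (le_of_mul_le_mul_right h1 hl) hge))
    obtain ⟨j, hj⟩ := hex
    obtain ⟨q, hq, hqM, hqa⟩ := exists_gaussian_anisotropy_eq ha hg hmax hj
    have hk : ∀ i, 0 < 1 - q * g i := fun i => by
      have := mul_le_mul_of_nonneg_left (hmax i) hq
      linarith
    have h1 := sum_div_le_of_anisotropicNorm_le b hγ hF h hk hqa.le
    have hqγ : q * γ ^ 2 < 1 := (mul_le_mul_of_nonneg_left hge hq).trans_lt hqM
    refine ⟨q, hq, hqγ, hk, ?_⟩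
    have hY : 0 < ∑ i, 1 / (1 - q * g i) :=
      Finset.sum_pos (fun i _ => one_div_pos.2 (hk i)) Finset.univ_nonempty
    have hYX : ∑ i, 1 / (1 - q * g i) - q * ∑ i, g i / (1 - q * g i) = l := by
      rw [Finset.mul_sum, ← Finset.sum_sub_distrib, hldef, ← nsmul_one, ← Finset.card_univ,
        ← Finset.sum_const]
      refine Finset.sum_congr rfl fun i _ => ?_
      have := (hk i).ne'
      field_simp
    set Y := ∑ i, 1 / (1 - q * g i)
    have h2 := mul_le_mul_of_nonneg_left h1 hq
    have h3 : 1 - q * γ ^ 2 ≤ (Y / l)⁻¹ := by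
      rw [inv_div, le_div_iff₀ hY]
      linarith
    have h4 := Real.log_le_log (by linarith) h3
    rw [Real.log_inv] at h4
    have h5 := mul_le_mul_of_nonneg_left h4 hl.le
    linarith

/-! ### Diagonalization of `FᵀF` -/

theorem norm_toEuclideanLin_sq_eq_diagQuadratic (F : Matrix σ ι ℝ) (hG : (Fᵀ * F).IsHermitian)
    (w : EuclideanSpace ℝ ι) :
    ‖Matrix.toEuclideanLin F w‖ ^ 2 = diagQuadratic hG.eigenvectorBasis hG.eigenvalues w := by
  set b := hG.eigenvectorBasis
  have hadj : ∀ x y : EuclideanSpace ℝ ι, inner ℝ (toEuclideanLin F x) (toEuclideanLin F y)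
      = inner ℝ x (toEuclideanLin (Fᵀ * F) y) := by
    intro x y
    simp only [EuclideanSpace.inner_eq_star_dotProduct, toLpLin_apply, star_trivial]
    rw [← mulVec_mulVec, dotProduct_mulVec, ← mulVec_transpose, dotProduct_comm]
  have heig : ∀ i, toEuclideanLin (Fᵀ * F) (b i) = hG.eigenvalues i • b i := by
    intro i
    ext j
    exact congrFun (hG.mulVec_eigenvectorBasis i) j
  have hrepr : ∀ i, inner ℝ (b i) (toEuclideanLin (Fᵀ * F) w)
      = hG.eigenvalues i * inner ℝ (b i) w := by
    intro i
    rw [← hadj, real_inner_comm, hadj, heig, inner_smul_right, real_inner_comm]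
  rw [← real_inner_self_eq_norm_sq, hadj, ← b.sum_inner_mul_inner, diagQuadratic]
  refine Finset.sum_congr rfl fun i _ => ?_
  rw [hrepr, b.repr_apply_apply, real_inner_comm]
  ring

theorem Matrix.IsHermitian.exists_isUnit_one_sub_smul {G : Matrix ι ι ℝ} (hG : G.IsHermitian) :
    ∃ U : Matrix ι ι ℝ, IsUnit U ∧ U * star U = 1 ∧
      ∀ q : ℝ, 1 - q • G = U * diagonal (fun i => 1 - q * hG.eigenvalues i) * star U := by
  have hU : (hG.eigenvectorUnitary : Matrix ι ι ℝ) * star (hG.eigenvectorUnitary : Matrix ι ι ℝ)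
    = 1 := Unitary.mul_star_self_of_mem hG.eigenvectorUnitary.2
  refine ⟨hG.eigenvectorUnitary, .of_mul_eq_one _ hU, hU, fun q => ?_⟩
  have hs := hG.spectral_theorem
  rw [Unitary.conjStarAlgAut_apply] at hs
  have hd : diagonal (fun i => 1 - q * hG.eigenvalues i)
      = 1 - q • diagonal (RCLike.ofReal ∘ hG.eigenvalues : ι → ℝ) := by
    ext i j
    by_cases h : i = j <;> simp [h]
  rw [hd, Matrix.mul_sub, Matrix.sub_mul, Matrix.mul_one, hU, Matrix.mul_smul, Matrix.smul_mul]
  exact congrArg (fun X => 1 - q • X) hs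

theorem Matrix.IsHermitian.posDef_one_sub_smul_iff {G : Matrix ι ι ℝ} (hG : G.IsHermitian)
    (q : ℝ) : (1 - q • G).PosDef ↔ ∀ i, 0 < 1 - q * hG.eigenvalues i := by
  obtain ⟨U, hU, -, h⟩ := hG.exists_isUnit_one_sub_smul
  rw [h, hU.posDef_star_right_conjugate_iff, posDef_diagonal_iff]

theorem Matrix.IsHermitian.det_one_sub_smul {G : Matrix ι ι ℝ} (hG : G.IsHermitian)
    (q : ℝ) : (1 - q • G).det = ∏ i, (1 - q * hG.eigenvalues i) := by
  obtain ⟨U, -, hU, h⟩ := hG.exists_isUnit_one_sub_smul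
  rw [h, det_mul_comm, ← Matrix.mul_assoc, mul_eq_one_comm.1 hU, Matrix.one_mul, det_diagonal]

theorem Matrix.IsHermitian.eq_smul_one_of_eigenvalues {G : Matrix ι ι ℝ} (hG : G.IsHermitian)
    {c : ℝ} (hc : ∀ i, hG.eigenvalues i = c) : G = c • 1 := by
  obtain ⟨U, -, hU, h⟩ := hG.exists_isUnit_one_sub_smul
  have h1 := h 1
  have hd : diagonal (fun _ : ι => 1 - 1 * c) = (1 - c) • (1 : Matrix ι ι ℝ) := by
    ext i j
    by_cases h : i = j <;> simp [h]
  simp only [hc] at h1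
  rw [hd, Matrix.mul_smul, Matrix.smul_mul, Matrix.mul_one, hU, sub_smul, one_smul, one_smul,
    sub_right_inj] at h1
  exact h1

/-- The bounded real lemma for the anisotropic norm of a single matrix. -/
theorem anisotropicNorm_le_iff (ha : 0 < a) (hγ : 0 ≤ γ) (hF : Fᵀ * F ≠ γ ^ 2 • 1) :
    anisotropicNorm F a ≤ ENNReal.ofReal γ ↔
      ∃ q : ℝ, 0 ≤ q ∧ q * γ ^ 2 < 1 ∧ (1 - q • (Fᵀ * F)).PosDef ∧
        Fintype.card ι * Real.log (1 - q * γ ^ 2) + 2 * a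
          ≤ Real.log (1 - q • (Fᵀ * F)).det := by
  have hpsd : (Fᵀ * F).PosSemidef := by
    simpa [conjTranspose_eq_transpose_of_trivial] using posSemidef_conjTranspose_mul_self F
  have hG := hpsd.isHermitian
  have hne : ∃ i, hG.eigenvalues i ≠ γ ^ 2 := by
    by_contra! h
    exact hF (hG.eq_smul_one_of_eigenvalues h)
  have : Nonempty ι := ⟨hne.choose⟩
  have hnorm := norm_toEuclideanLin_sq_eq_diagQuadratic F hG
  have hlog : ∀ q : ℝ, (∀ i, 0 < 1 - q * hG.eigenvalues i) →
      Real.log (1 - q • (Fᵀ * F)).det = ∑ i, Real.log (1 - q * hG.eigenvalues i) := fun q hq => by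
    rw [hG.det_one_sub_smul, Real.log_prod fun i _ => (hq i).ne']
  simp only [hG.posDef_one_sub_smul_iff]
  constructor
  · intro h
    obtain ⟨q, hq, hqγ, hk, hle⟩ := exists_log_le_of_anisotropicNorm_le _ ha hγ hnorm
      hpsd.eigenvalues_nonneg hne h
    exact ⟨q, hq, hqγ, hk, by rwa [hlog q hk]⟩
  · rintro ⟨q, hq, hqγ, hk, hle⟩
    rw [hlog q hk] at hle
    exact anisotropicNorm_le_of_log_le _ ha hγ hnorm hq hqγ hk hle

end NormBound

theorem theorem1 {n m r : ℕ} (N : ℕ) (F : LDTVSystem n m r) (a γ : ℝ)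
    (ha : 0 < a) (hγ : 0 ≤ γ)
    (hF : (F.ioMatrix N)ᵀ * F.ioMatrix N ≠ γ ^ 2 • 1) :
    anisotropicNorm (F.ioMatrix N) a ≤ ENNReal.ofReal γ ↔
      ∃ q : ℝ, 0 ≤ q ∧ q * γ ^ 2 < 1 ∧
        (∀ k ≤ N, (F.riccatiS q k).PosDef) ∧
        (m : ℝ) * ((N : ℝ) + 1) * Real.log (1 - q * γ ^ 2) + 2 * a ≤
          ∑ k ∈ Finset.range (N + 1), Real.log (F.riccatiS q k).det := by
  rw [anisotropicNorm_le_iff ha hγ hF]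
  refine exists_congr fun q => and_congr_right fun hq => and_congr_right fun _ => ?_
  rw [F.posDef_riccatiS_iff, posDef_one_sub_smul_mul_transpose_iff _ hq]
  refine and_congr_right fun hpd => ?_
  have hS := (F.posDef_riccatiS_iff q N).2 ((posDef_one_sub_smul_mul_transpose_iff _ hq).2 hpd)
  rw [← F.prod_det_riccatiS q N hS, Real.log_prod fun k hk =>
    (hS k (Nat.lt_succ_iff.1 (Finset.mem_range.1 hk))).det_pos.ne']
  simp [mul_comm]
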